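/- **Setting.** Let $\Gamma$ be a (typically infinite) set of lattice sites and let $\mathcal A$ be a unital $C^*$-algebra with a family of local subalgebras $\mathcal A(I)$, $I\Subset\Gamma$ finite, each a full matrix algebra, increasing in $I$ and with norm dense union. For arbitrary $S\subset\Gamma$, $\mathcal A(S)$ is the norm closure of $\bigcup_{I\Subset S}\mathcal A(I)$. Suppose that $\mathcal A$ is either a *quantum spin lattice system*, i.e. $\mathcal A(I\cup J)=\mathcal A(I)\otimes\mathcal A(J)$ for disjoint finite $I,J$, or a *fermion lattice system*, i.e. $\mathcal A$ is generated by $c_i$ ($i\in\Gamma$) satisfying the canonical anticommutation relations, and $\mathcal A(I)$ is generated by $c_i,c_i^*$, $i\in I$. In the fermion case let $\Theta$ be the automorphism of $\mathcal A$ with $\Theta(c_i)=-c_i$; an element or a state is *even* if it is $\Theta$-invariant. For a state $\psi$ let $S_I(\psi)=-\mathrm{Tr}(D\log D)$ be the von Neumann entropy of its restriction to $\mathcal A(I)$, $D$ being the density matrix. For finite $I$ and $J\subset I^c$ (finite or infinite) put $$\widetilde S_{I|J}(\psi)=\inf_{\Lambda\Subset J}\{S_{I\cup\Lambda}(\psi)-S_\Lambda(\psi)\},\qquad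 I_\psi(I:J)=S_I(\psi)-\widetilde S_{I|J}(\psi).$$ A *potential* $\Phi$ assigns to each finite $K\Subset\Gamma$ a self-adjoint $\Phi(K)\in\mathcal A(K)$ (even, in the fermion case) such that for every finite $I$ the surface energy $$H_{\partial I}=\sum_{K\cap I\neq\emptyset,\ K\cap I^c\neq\emptyset}\Phi(K)$$ exists in $\mathcal A$, as the norm limit over finite $J\nearrow\Gamma$ of the sums over $K\subset J$. Put $H_I=\sum_{K\subset I}\Phi(K)$. A state $\varphi$ satisfies *local thermodynamical stability* (LTS) for $\Phi$ at inverse temperature $\beta>0$ if for every finite $I$ it minimizes $$\widetilde F_I(\psi)=\psi(H_I+H_{\partial I})-\tfrac1\beta\,\widetilde S_{I|I^c}(\psi)$$ among all states $\psi$ of $\mathcal A$ that agree with $\varphi$ on $\mathcal A(I^c)$. Let $\partial A$ denote the support of $H_{\partial A}$, i.e. the smallest region $S$ with $H_{\partial A}\in\mathcal A(S)$, and $|\partial A|\in\{0,1,2,\dots,\infty\}$ its number of sites. **Claim (geometric thermal area law).** Let $\beta>0$ and let $\varphi$ be a state satisfying LTS for $\Phi$ at inverse temperature $\beta$ in the quantum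 spin case, or an even such state in the fermion case. Let $A\Subset\Gamma$ be finite and let $c_\Phi>0$ be a constant with $\lVert H_{\partial A}\rVert\le c_\Phi\,|\partial A|$. Then for every (finite or infinite) region $B\subset A^c$, $$I_\varphi(A:B)\le 2\beta\,c_\Phi\,|\partial A| .$$ -/

import Mathlib

open Filter Topology
open scoped ComplexOrder

namespace QLattice

/-! ## Quasi-local systems, regions, states -/

/-- A quasi-local C*-system on the lattice `Γ` with total algebra `𝒜`: an increasing family of
local subalgebras, one for each finite region, each a full matrix algebra, with norm dense union. -/
structure QuasiLocal (Γ : Type*) (𝒜 : Type*) [CStarAlgebra 𝒜] where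
  /-- the local algebra of a finite region -/
  loc : Finset Γ → StarSubalgebra ℂ 𝒜
  mono : ∀ I J : Finset Γ, I ⊆ J → loc I ≤ loc J
  matrix : ∀ I : Finset Γ, ∃ n : ℕ, Nonempty (loc I ≃⋆ₐ[ℂ] Matrix (Fin n) (Fin n) ℂ)
  dense : Dense (⋃ I : Finset Γ, (loc I : Set 𝒜))

/-- A quantum spin lattice system: for disjoint finite regions `I`, `J`, the algebra of `I ∪ J` is
the tensor product of the algebras of `I` and of `J`, that is, the two subalgebras commute, the
multiplication map from their algebraic tensor product is injective, and they generate. -/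
structure SpinSystem (Γ : Type*) (𝒜 : Type*) [DecidableEq Γ] [CStarAlgebra 𝒜] extends
    QuasiLocal Γ 𝒜 where
  commute : ∀ I J : Finset Γ, Disjoint I J → ∀ a ∈ loc I, ∀ b ∈ loc J, a * b = b * a
  linearDisjoint : ∀ I J : Finset Γ, Disjoint I J →
    (loc I).toSubalgebra.LinearDisjoint (loc J).toSubalgebra
  sup : ∀ I J : Finset Γ, Disjoint I J → loc (I ∪ J) = loc I ⊔ loc J

/-- A (spinless) fermion lattice system: annihilation operators `c i`, one for each site, satisfying
the canonical anticommutation relations and generating the C*-algebra `𝒜`. -/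
structure FermionSystem (Γ : Type*) (𝒜 : Type*) [DecidableEq Γ] [CStarAlgebra 𝒜] where
  /-- the annihilation operator of a site -/
  c : Γ → 𝒜
  car : ∀ i j : Γ, star (c i) * c j + c j * star (c i) = if i = j then 1 else 0
  car_zero : ∀ i j : Γ, c i * c j + c j * c i = 0
  dense : Dense (StarAlgebra.adjoin ℂ (Set.range c) : Set 𝒜)

/-- A state: a positive normalized linear functional. -/
structure State (𝒜 : Type*) [CStarAlgebra 𝒜] where
  /-- the underlying functional -/
  toLin : 𝒜 →ₗ[ℂ] ℂ
  nonneg : ∀ a : 𝒜, 0 ≤ toLin (star a * a)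
  map_one : toLin 1 = 1

noncomputable instance (𝒜 : Type*) [CStarAlgebra 𝒜] : CoeFun (State 𝒜) (fun _ => 𝒜 → ℂ) :=
  ⟨fun φ => φ.toLin⟩

namespace FermionSystem

variable {Γ 𝒜 : Type*} [DecidableEq Γ] [CStarAlgebra 𝒜] (F : FermionSystem Γ 𝒜)

/-- The local algebra of a finite region, generated by the `c i` and their adjoints. -/
def loc (I : Finset Γ) : StarSubalgebra ℂ 𝒜 := StarAlgebra.adjoin ℂ (F.c '' (I : Set Γ))

theorem loc_mono (I J : Finset Γ) (h : I ⊆ J) : F.loc I ≤ F.loc J :=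
  StarAlgebra.adjoin_mono (Set.image_mono (Finset.coe_subset.mpr h))

theorem c_mem (i : Γ) (I : Finset Γ) (h : i ∈ I) : F.c i ∈ F.loc I :=
  StarAlgebra.subset_adjoin ℂ _ ⟨i, h, rfl⟩

theorem local_dense : Dense (⋃ I : Finset Γ, (F.loc I : Set 𝒜)) := by
  refine F.dense.mono fun a ha => ?_
  rw [Set.mem_iUnion]
  refine StarAlgebra.adjoin_induction (p := fun a _ => ∃ I, a ∈ (F.loc I : Set 𝒜))
    ?_ ?_ ?_ ?_ ?_ ha
  · rintro _ ⟨i, rfl⟩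
    exact ⟨{i}, F.c_mem i _ (Finset.mem_singleton_self i)⟩
  · exact fun r => ⟨∅, (F.loc ∅).algebraMap_mem r⟩
  · rintro x y _ _ ⟨I, hI⟩ ⟨J, hJ⟩
    exact ⟨I ∪ J, add_mem (F.loc_mono I _ Finset.subset_union_left hI)
      (F.loc_mono J _ Finset.subset_union_right hJ)⟩
  · rintro x y _ _ ⟨I, hI⟩ ⟨J, hJ⟩
    exact ⟨I ∪ J, mul_mem (F.loc_mono I _ Finset.subset_union_left hI)
      (F.loc_mono J _ Finset.subset_union_right hJ)⟩
  · rintro x _ ⟨I, hI⟩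
    exact ⟨I, star_mem (s := F.loc I) hI⟩

theorem c_sq (i : Γ) : F.c i * F.c i = 0 := by
  have h := F.car_zero i i
  rw [← two_smul ℂ, smul_eq_zero] at h
  exact h.resolve_left two_ne_zero

theorem c_anti (i j : Γ) : F.c i * F.c j = -(F.c j * F.c i) :=
  eq_neg_of_add_eq_zero_left (F.car_zero i j)

theorem star_anti (i j : Γ) (h : i ≠ j) : star (F.c i) * F.c j = -(F.c j * star (F.c i)) :=
  eq_neg_of_add_eq_zero_left (by rw [F.car i j, if_neg h])

theorem star_self (i : Γ) : star (F.c i) * F.c i = 1 - F.c i * star (F.c i) :=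
  eq_sub_of_add_eq (by rw [F.car i i, if_pos rfl])

/-- A self-adjoint unitary in the algebra of `I` which anticommutes with `c i` for `i` in `I`, and
commutes with the other `c j`. -/
theorem exists_parity (I : Finset Γ) : ∃ u : 𝒜, u ∈ F.loc I ∧ star u = u ∧ u * u = 1 ∧
    (∀ i ∈ I, u * F.c i = -(F.c i * u)) ∧ (∀ j, j ∉ I → u * F.c j = F.c j * u) := by
  induction I using Finset.induction_on with
  | empty => exact ⟨1, one_mem _, star_one _, mul_one _, by simp, by simp⟩
  | insert j I hj ih =>
    obtain ⟨u, hu, hs, h1, ha, hc⟩ := ih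
    have hcj := F.c_mem j (insert j I) (Finset.mem_insert_self j I)
    set v : 𝒜 := 1 - (2 : ℂ) • (star (F.c j) * F.c j) with hv
    have uc : u * F.c j = F.c j * u := hc j hj
    have us : u * star (F.c j) = star (F.c j) * u := by
      have := congrArg star uc
      rw [star_mul, star_mul, hs] at this
      exact this.symm
    have uN : u * (star (F.c j) * F.c j) = star (F.c j) * F.c j * u := by
      rw [← mul_assoc, us, mul_assoc, uc, mul_assoc]
    have uv : u * v = v * u := by
      simp only [hv, mul_sub, sub_mul, mul_one, one_mul, mul_smul_comm, smul_mul_assoc, uN]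
    have sv : star v = v := by
      simp [hv, star_sub, star_smul, star_mul]
    have cN : star (F.c j) * F.c j * F.c j = 0 := by rw [mul_assoc, F.c_sq, mul_zero]
    have Nc : F.c j * (star (F.c j) * F.c j) = F.c j := by
      rw [F.star_self, mul_sub, mul_one, ← mul_assoc, F.c_sq, zero_mul, sub_zero]
    have NN : star (F.c j) * F.c j * (star (F.c j) * F.c j) = star (F.c j) * F.c j := by
      rw [mul_assoc, Nc]
    have vv : v * v = 1 := by
      simp only [hv, mul_sub, sub_mul, mul_one, one_mul, mul_smul_comm, smul_mul_assoc, NN]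
      module
    have vc : v * F.c j = -(F.c j * v) := by
      simp only [hv, mul_sub, sub_mul, mul_one, one_mul, mul_smul_comm, smul_mul_assoc, cN, Nc]
      module
    have vo : ∀ i, i ≠ j → v * F.c i = F.c i * v := by
      intro i hi
      have : star (F.c j) * F.c j * F.c i = F.c i * (star (F.c j) * F.c j) := by
        rw [mul_assoc, F.c_anti j i, mul_neg, ← mul_assoc, F.star_anti j i (Ne.symm hi), neg_mul,
          neg_neg, mul_assoc]
      simp only [hv, mul_sub, sub_mul, mul_one, one_mul, mul_smul_comm, smul_mul_assoc, this]
    refine ⟨u * v, ?_, ?_, ?_, ?_, ?_⟩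
    · refine mul_mem (F.loc_mono I _ (Finset.subset_insert j I) hu) ?_
      exact sub_mem (one_mem _) (SMulMemClass.smul_mem _ (mul_mem (star_mem hcj) hcj))
    · rw [star_mul, hs, sv, uv]
    · rw [mul_assoc, ← mul_assoc v, ← uv, mul_assoc u, vv, mul_one, h1]
    · intro i hi
      by_cases hij : i = j
      · subst hij
        rw [mul_assoc, vc, mul_neg, ← mul_assoc, uc, mul_assoc]
      · have hi' : i ∈ I := (Finset.mem_insert.mp hi).resolve_left hij
        rw [mul_assoc, vo i hij, ← mul_assoc, ha i hi', neg_mul, mul_assoc]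
    · intro i hi
      rw [Finset.mem_insert, not_or] at hi
      rw [mul_assoc, vo i hi.1, ← mul_assoc, hc i hi.2, mul_assoc]

/-- Two inner automorphisms that agree on the generators of a local algebra agree on it. -/
theorem conj_eq_of_gen (u v : 𝒜) (hu : star u = u) (hu1 : u * u = 1) (hv : star v = v)
    (hv1 : v * v = 1) (I : Finset Γ) (h : ∀ i ∈ I, u * F.c i * u = v * F.c i * v) (a : 𝒜)
    (ha : a ∈ F.loc I) : u * a * u = v * a * v := by
  refine StarAlgebra.adjoin_induction (p := fun a _ => u * a * u = v * a * v)
    ?_ ?_ ?_ ?_ ?_ ha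
  · rintro _ ⟨i, hi, rfl⟩
    exact h i hi
  · intro r
    rw [← Algebra.commutes, ← Algebra.commutes, mul_assoc, mul_assoc, hu1, hv1]
  · intro x y _ _ hx hy
    rw [mul_add, mul_add, add_mul, add_mul, hx, hy]
  · intro x y _ _ hx hy
    calc u * (x * y) * u = u * x * (u * u) * y * u := by rw [hu1]; simp only [mul_assoc, one_mul]
      _ = u * x * u * (u * y * u) := by simp only [mul_assoc]
      _ = v * x * v * (v * y * v) := by rw [hx, hy]
      _ = v * x * (v * v) * y * v := by simp only [mul_assoc]
      _ = v * (x * y) * v := by rw [hv1]; simp only [mul_assoc, one_mul]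
  · intro x _ hx
    have := congrArg star hx
    simpa [star_mul, hu, hv, mul_assoc] using this

/-- The grading automorphism exists and is unique. -/
theorem exists_grading : ∃ Θ : 𝒜 ≃⋆ₐ[ℂ] 𝒜, ∀ i, Θ (F.c i) = -F.c i := by
  choose u hu hs h1 ha hc using F.exists_parity
  have norm_le : ∀ I a, ‖u I * a * u I‖ ≤ ‖a‖ := by
    intro I a
    have hn : ‖u I‖ ≤ 1 := by
      have h := CStarRing.norm_star_mul_self (x := u I)
      rw [hs, h1] at h
      have h2 : ‖(1 : 𝒜)‖ ≤ 1 := by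
        rcases subsingleton_or_nontrivial 𝒜 with _ | _
        · rw [Subsingleton.elim (1 : 𝒜) 0, norm_zero]; exact zero_le_one
        · exact CStarRing.norm_one.le
      nlinarith [norm_nonneg (u I)]
    calc ‖u I * a * u I‖ ≤ ‖u I‖ * ‖a‖ * ‖u I‖ := norm_mul₃_le
      _ ≤ 1 * ‖a‖ * 1 := by gcongr
      _ = ‖a‖ := by ring
  have gen : ∀ I, ∀ i ∈ I, u I * F.c i * u I = -F.c i := by
    intro I i hi
    rw [ha I i hi, neg_mul, mul_assoc, h1, mul_one]
  have stable : ∀ I J, I ⊆ J → ∀ a ∈ F.loc I, u J * a * u J = u I * a * u I := by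
    intro I J hIJ a haI
    refine F.conj_eq_of_gen _ _ (hs J) (h1 J) (hs I) (h1 I) I (fun i hi => ?_) a haI
    rw [gen I i hi, gen J i (hIJ hi)]
  have lim : ∀ a, ∃ b, Tendsto (fun I => u I * a * u I) atTop (𝓝 b) := by
    intro a
    refine cauchySeq_tendsto_of_complete (Metric.cauchySeq_iff'.mpr fun ε hε => ?_)
    obtain ⟨b, hb, hab⟩ := Metric.mem_closure_iff.mp (F.local_dense a) (ε / 2) (half_pos hε)
    obtain ⟨I, hI⟩ := Set.mem_iUnion.mp hb
    refine ⟨I, fun J hJ => ?_⟩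
    have e : u J * a * u J - u I * a * u I = u J * (a - b) * u J - u I * (a - b) * u I := by
      have := stable I J hJ b hI
      simp only [mul_sub, sub_mul, this]
      abel
    rw [dist_eq_norm] at hab ⊢
    rw [e]
    have n1 := norm_le J (a - b)
    have n2 := norm_le I (a - b)
    linarith [norm_sub_le (u J * (a - b) * u J) (u I * (a - b) * u I)]
  choose T hT using lim
  have T_mul : ∀ a b, T (a * b) = T a * T b := by
    intro a b
    refine tendsto_nhds_unique (hT (a * b)) (((hT a).mul (hT b)).congr fun I => ?_)
    calc u I * a * u I * (u I * b * u I) = u I * a * (u I * u I) * b * u I := by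
          simp only [mul_assoc]
      _ = u I * (a * b) * u I := by rw [h1]; simp only [mul_assoc, one_mul]
  have T_add : ∀ a b, T (a + b) = T a + T b := by
    intro a b
    refine tendsto_nhds_unique (hT (a + b)) (((hT a).add (hT b)).congr fun I => ?_)
    rw [mul_add, add_mul]
  have T_smul : ∀ (r : ℂ) a, T (r • a) = r • T a := by
    intro r a
    refine tendsto_nhds_unique (hT (r • a)) (((hT a).const_smul r).congr fun I => ?_)
    rw [mul_smul_comm, smul_mul_assoc]
  have T_star : ∀ a, T (star a) = star (T a) := by
    intro a
    refine tendsto_nhds_unique (hT (star a)) ((hT a).star.congr fun I => ?_)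
    simp only [star_mul, hs, mul_assoc]
  have T_norm : ∀ a, ‖T a‖ ≤ ‖a‖ := fun a =>
    le_of_tendsto (hT a).norm (Eventually.of_forall fun I => norm_le I a)
  have T_loc : ∀ I, ∀ a ∈ F.loc I, T a = u I * a * u I := by
    intro I a haI
    refine tendsto_nhds_unique (hT a) (tendsto_const_nhds.congr' ?_)
    filter_upwards [eventually_ge_atTop I] with J hJ
    exact (stable I J hJ a haI).symm
  have T_cont : Continuous T := by
    refine LipschitzWith.continuous (K := 1) (LipschitzWith.of_dist_le_mul fun a b => ?_)
    have : T a - T b = T (a - b) := by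
      rw [sub_eq_add_neg, sub_eq_add_neg, T_add, ← neg_one_smul ℂ b, T_smul, neg_one_smul]
    rw [dist_eq_norm, dist_eq_norm, this, NNReal.coe_one, one_mul]
    exact T_norm _
  have T_invol : ∀ a, T (T a) = a := by
    have : T ∘ T = id := by
      refine Continuous.ext_on F.local_dense (T_cont.comp T_cont) continuous_id ?_
      intro a haU
      obtain ⟨I, hI⟩ := Set.mem_iUnion.mp haU
      have hI' : u I * a * u I ∈ F.loc I := mul_mem (mul_mem (hu I) hI) (hu I)
      simp only [Function.comp_apply, id_eq]
      rw [T_loc I a hI, T_loc I _ hI']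
      calc u I * (u I * a * u I) * u I = (u I * u I) * a * (u I * u I) := by simp only [mul_assoc]
        _ = a := by rw [h1, one_mul, mul_one]
    exact fun a => congrFun this a
  refine ⟨{ toFun := T, invFun := T, left_inv := T_invol, right_inv := T_invol, map_mul' := T_mul
            map_add' := T_add, map_star' := T_star, map_smul' := T_smul }, fun i => ?_⟩
  change T (F.c i) = -F.c i
  rw [T_loc {i} _ (F.c_mem i _ (Finset.mem_singleton_self i))]
  exact gen _ i (Finset.mem_singleton_self i)

/-- The grading automorphism `Θ`, the one that maps every `c i` to `- c i` (unique because the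
`c i` generate). -/
noncomputable def grading : 𝒜 ≃⋆ₐ[ℂ] 𝒜 := F.exists_grading.choose

theorem grading_c (i : Γ) : F.grading (F.c i) = -F.c i := F.exists_grading.choose_spec i

/-- A state is even if it is invariant under the grading automorphism. -/
def IsEvenState (φ : State 𝒜) : Prop := ∀ a : 𝒜, φ (F.grading a) = φ a

/-- Adjoining one more mode doubles the matrix size: `e` represents a matrix algebra, and `b` is
an annihilation operator commuting with its range. -/
theorem double {ι : Type} [Fintype ι] [DecidableEq ι] (e : Matrix ι ι ℂ →⋆ₐ[ℂ] 𝒜) (b : 𝒜)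
    (hb : b * b = 0) (hbb : star b * b + b * star b = 1)
    (hc : ∀ X, e X * b = b * e X) :
    ∃ e' : Matrix (Fin 2 × ι) (Fin 2 × ι) ℂ →⋆ₐ[ℂ] 𝒜,
      (∀ M, ∃ x : Fin 2 → Fin 2 → Matrix ι ι ℂ, e' M = e (x 0 0) * (b * star b) + e (x 0 1) * b +
        e (x 1 0) * star b + e (x 1 1) * (star b * b)) ∧
      (∀ X, ∃ M, e' M = e X) ∧ (∃ M, e' M = b) := by
  have hcs : ∀ X, e X * star b = star b * e X := by
    intro X
    have h := congrArg star (hc (star X))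
    rw [star_mul, star_mul, map_star, star_star] at h
    exact h.symm
  have hsb : star b * star b = 0 := by rw [← star_mul, hb, star_zero]
  have b1 : b * (star b * b) = b := by
    have : star b * b = 1 - b * star b := eq_sub_of_add_eq hbb
    rw [this, mul_sub, mul_one, ← mul_assoc, hb, zero_mul, sub_zero]
  have b2 : star b * (b * star b) = star b := by
    have : b * star b = 1 - star b * b := eq_sub_of_add_eq' hbb
    rw [this, mul_sub, mul_one, ← mul_assoc, hsb, zero_mul, sub_zero]
  have bb0 : ∀ x, b * (b * x) = 0 := fun x => by rw [← mul_assoc, hb, zero_mul]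
  have ss0 : ∀ x, star b * (star b * x) = 0 := fun x => by rw [← mul_assoc, hsb, zero_mul]
  have b3 : b * (star b * (b * star b)) = b * star b := by rw [b2]
  have b4 : star b * (b * (star b * b)) = star b * b := by rw [b1]
  let f : Fin 2 → Fin 2 → 𝒜 := ![![b * star b, b], ![star b, star b * b]]
  have hf : ∀ p q r s, f p q * f r s = if q = r then f p s else 0 := by
    intro p q r s
    fin_cases p <;> fin_cases q <;> fin_cases r <;> fin_cases s <;>
      simp [f, mul_assoc, hb, hsb, b1, b2, bb0, ss0]
  have hfs : ∀ p q, star (f p q) = f q p := by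
    intro p q
    fin_cases p <;> fin_cases q <;> simp [f]
  have hf1 : f 0 0 + f 1 1 = 1 := by
    simp only [f, Matrix.cons_val_zero, Matrix.cons_val_one]
    rw [add_comm]; exact hbb
  have hfc : ∀ X p q, f p q * e X = e X * f p q := by
    intro X p q
    fin_cases p <;> fin_cases q
    · simp only [f]
      change b * star b * e X = e X * (b * star b)
      rw [mul_assoc, ← hcs, ← mul_assoc, ← hc, mul_assoc]
    · exact (hc X).symm
    · exact (hcs X).symm
    · change star b * b * e X = e X * (star b * b)
      rw [mul_assoc, ← hc, ← mul_assoc, ← hcs, mul_assoc]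
  let blk : Matrix (Fin 2 × ι) (Fin 2 × ι) ℂ → Fin 2 → Fin 2 → Matrix ι ι ℂ :=
    fun M p q => Matrix.of fun i j => M (p, i) (q, j)
  let T : Matrix (Fin 2 × ι) (Fin 2 × ι) ℂ → 𝒜 := fun M => ∑ p, ∑ q, e (blk M p q) * f p q
  have blk_mul : ∀ M N p s, blk (M * N) p s = ∑ q, blk M p q * blk N q s := by
    intro M N p s
    ext i j
    simp [blk, Matrix.mul_apply, Fintype.sum_prod_type, Matrix.sum_apply]
  have blk_one : ∀ p q, blk 1 p q = if p = q then 1 else 0 := by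
    intro p q
    ext i j
    by_cases h : p = q
    · simp [blk, h, Matrix.one_apply]
    · simp [blk, h]
  have T_one : T 1 = 1 := by
    simp only [T, blk_one, Fin.sum_univ_two]
    simp [hf1]
  have T_mul : ∀ M N, T (M * N) = T M * T N := by
    intro M N
    have key : ∀ p q r s, e (blk M p q) * f p q * (e (blk N r s) * f r s) =
        if q = r then e (blk M p q * blk N r s) * f p s else 0 := by
      intro p q r s
      calc e (blk M p q) * f p q * (e (blk N r s) * f r s)
          = e (blk M p q) * (f p q * e (blk N r s)) * f r s := by simp only [mul_assoc]
        _ = e (blk M p q * blk N r s) * (f p q * f r s) := by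
            rw [hfc, map_mul]; simp only [mul_assoc]
        _ = _ := by rw [hf]; split_ifs <;> simp
    simp only [T, blk_mul, map_sum, Finset.sum_mul, Finset.mul_sum, key]
    simp only [Fin.sum_univ_two]
    simp
    abel
  have T_star : ∀ M, T (star M) = star (T M) := by
    intro M
    have hb' : ∀ p q, blk (star M) p q = star (blk M q p) := by
      intro p q
      ext i j
      simp [blk, Matrix.star_apply]
    have : ∀ p q, e (blk (star M) p q) * f p q = star (e (blk M q p) * f q p) := by
      intro p q
      rw [hb', star_mul, hfs, map_star, ← map_star, hfc]
    simp only [T, this, star_sum]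
    exact Finset.sum_comm
  have T_smul : ∀ (r : ℂ) M, T (r • M) = r • T M := by
    intro r M
    have : ∀ p q, blk (r • M) p q = r • blk M p q := fun p q => rfl
    simp only [T, this, map_smul, smul_mul_assoc, Finset.smul_sum]
  have T_add : ∀ M N, T (M + N) = T M + T N := by
    intro M N
    have : ∀ p q, blk (M + N) p q = blk M p q + blk N p q := fun p q => rfl
    simp only [T, this, map_add, add_mul, Finset.sum_add_distrib]
  have T_zero : T 0 = 0 := by
    have := T_smul 0 0
    simpa using this
  refine ⟨{ toFun := T, map_one' := T_one, map_mul' := T_mul, map_zero' := T_zero,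
            map_add' := T_add, map_star' := T_star, commutes' := fun r => ?_ }, ?_, ?_, ?_⟩
  · change T (algebraMap ℂ _ r) = algebraMap ℂ _ r
    rw [Algebra.algebraMap_eq_smul_one, T_smul, T_one, Algebra.algebraMap_eq_smul_one]
  · intro M
    refine ⟨blk M, ?_⟩
    change T M = _
    simp only [T, Fin.sum_univ_two]
    simp [f, add_assoc]
  · intro X
    refine ⟨Matrix.of fun x y => if x.1 = y.1 then X x.2 y.2 else 0, ?_⟩
    change T _ = _
    have : ∀ p q, blk (Matrix.of fun x y => if x.1 = y.1 then X x.2 y.2 else 0) p q =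
        if p = q then X else 0 := by
      intro p q
      ext i j
      by_cases h : p = q <;> simp [blk, h]
    simp only [T, this, Fin.sum_univ_two]
    simp [← mul_add, hf1]
  · refine ⟨Matrix.of fun x y => if x.1 = 0 ∧ y.1 = 1 ∧ x.2 = y.2 then 1 else 0, ?_⟩
    change T _ = _
    have : ∀ p q, blk (Matrix.of fun x y => if x.1 = 0 ∧ y.1 = 1 ∧ x.2 = y.2 then 1 else 0) p q =
        if p = 0 ∧ q = 1 then 1 else 0 := by
      intro p q
      ext i j
      by_cases h : p = 0 ∧ q = 1
      · simp [blk, h, Matrix.one_apply]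
      · rw [if_neg h]
        simp only [blk, Matrix.of_apply, Matrix.zero_apply]
        exact if_neg fun h' => h ⟨h'.1, h'.2.1⟩
    simp only [T, this, Fin.sum_univ_two]
    simp [f]

/-- The local algebras are full matrix algebras. -/
theorem loc_matrix [Nontrivial 𝒜] (I : Finset Γ) :
    ∃ n : ℕ, Nonempty (F.loc I ≃⋆ₐ[ℂ] Matrix (Fin n) (Fin n) ℂ) := by
  have main : ∃ (ι : Type) (_ : Fintype ι) (_ : DecidableEq ι) (e : Matrix ι ι ℂ →⋆ₐ[ℂ] 𝒜),
      e.range = F.loc I := by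
    induction I using Finset.induction_on with
    | empty =>
      refine ⟨Unit, inferInstance, inferInstance,
        { toFun := fun M => algebraMap ℂ 𝒜 (M () ()), map_one' := by simp, map_zero' := by simp
          map_mul' := fun M N => by simp [Matrix.mul_apply]
          map_add' := fun M N => by simp
          map_star' := fun M => by
            rw [Matrix.star_apply, algebraMap_star_comm]
          commutes' := fun r => by simp [Matrix.algebraMap_matrix_apply] }, ?_⟩
      have h0 : F.loc ∅ = ⊥ := by
        rw [loc, Finset.coe_empty, Set.image_empty]
        exact le_antisymm (StarAlgebra.adjoin_le (Set.empty_subset _)) bot_le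
      rw [h0]
      ext a
      rw [StarSubalgebra.mem_bot]
      constructor
      · rintro ⟨M, rfl⟩
        exact ⟨M () (), rfl⟩
      · rintro ⟨r, rfl⟩
        exact ⟨Matrix.of fun _ _ => r, rfl⟩
    | insert j I hj ih =>
      obtain ⟨ι, _, _, e, he⟩ := ih
      obtain ⟨u, hu, hs, h1, ha, hc⟩ := F.exists_parity I
      have e_mem : ∀ X, e X ∈ F.loc I := fun X => he ▸ (⟨X, rfl⟩ : e X ∈ e.range)
      have mem_e : ∀ a ∈ F.loc I, ∃ X, e X = a := by
        intro a haI
        rw [← he] at haI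
        exact haI
      have uc : u * F.c j = F.c j * u := hc j hj
      have us : u * star (F.c j) = star (F.c j) * u := by
        have := congrArg star uc
        rw [star_mul, star_mul, hs] at this
        exact this.symm
      have sb : star (u * F.c j) = star (F.c j) * u := by rw [star_mul, hs]
      have hcomm : ∀ a ∈ F.loc I, a * (u * F.c j) = (u * F.c j) * a ∧
          star a * (u * F.c j) = (u * F.c j) * star a := by
        intro a haI
        refine StarAlgebra.adjoin_induction (p := fun a _ => a * (u * F.c j) = (u * F.c j) * a ∧
          star a * (u * F.c j) = (u * F.c j) * star a) ?_ ?_ ?_ ?_ ?_ haI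
        · rintro _ ⟨i, hi, rfl⟩
          have hij : i ≠ j := fun h => hj (h ▸ hi)
          have ui : u * F.c i = -(F.c i * u) := ha i hi
          have usi : u * star (F.c i) = -(star (F.c i) * u) := by
            have := congrArg star ui
            rw [star_neg, star_mul, star_mul, hs] at this
            rw [this, neg_neg]
          constructor
          · rw [mul_assoc u, F.c_anti j i, mul_neg, ← mul_assoc u, ui, neg_mul, neg_neg, mul_assoc]
          · have h2 : F.c j * star (F.c i) = -(star (F.c i) * F.c j) := by
              rw [F.star_anti i j hij, neg_neg]
            rw [mul_assoc u, h2, mul_neg, ← mul_assoc u, usi, neg_mul, neg_neg, mul_assoc]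
        · intro r
          refine ⟨Algebra.commutes _ _, ?_⟩
          rw [← algebraMap_star_comm]
          exact Algebra.commutes _ _
        · rintro x y _ _ ⟨hx, hx'⟩ ⟨hy, hy'⟩
          exact ⟨by rw [add_mul, mul_add, hx, hy], by rw [star_add, add_mul, mul_add, hx', hy']⟩
        · rintro x y _ _ ⟨hx, hx'⟩ ⟨hy, hy'⟩
          exact ⟨by rw [mul_assoc, hy, ← mul_assoc, hx, mul_assoc],
            by rw [star_mul, mul_assoc, hx', ← mul_assoc, hy', mul_assoc]⟩
        · rintro x _ ⟨hx, hx'⟩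
          exact ⟨hx', by rw [star_star]; exact hx⟩
      have hbb : star (u * F.c j) * (u * F.c j) = star (F.c j) * F.c j := by
        rw [sb, mul_assoc, ← mul_assoc u, h1, one_mul]
      have hbb' : (u * F.c j) * star (u * F.c j) = F.c j * star (F.c j) := by
        rw [sb, uc, mul_assoc, ← mul_assoc u, us, mul_assoc, h1, mul_one]
      obtain ⟨e', h_form, h_e, U, hU⟩ := double e (u * F.c j)
        (by rw [mul_assoc, ← mul_assoc (F.c j), ← uc, mul_assoc u, F.c_sq, mul_zero, mul_zero])
        (by rw [hbb, hbb', F.car j j, if_pos rfl]) (fun X => (hcomm _ (e_mem X)).1)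
      refine ⟨Fin 2 × ι, inferInstance, inferInstance, e', le_antisymm ?_ ?_⟩
      · rintro _ ⟨M, rfl⟩
        obtain ⟨x, hx⟩ := h_form M
        have hb_mem : u * F.c j ∈ F.loc (insert j I) :=
          mul_mem (F.loc_mono I _ (Finset.subset_insert j I) hu)
            (F.c_mem j _ (Finset.mem_insert_self j I))
        have e_mem' : ∀ X, e X ∈ F.loc (insert j I) := fun X =>
          F.loc_mono I _ (Finset.subset_insert j I) (e_mem X)
        change e' M ∈ F.loc (insert j I)
        rw [hx]
        exact add_mem (add_mem (add_mem (mul_mem (e_mem' _) (mul_mem hb_mem (star_mem hb_mem)))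
          (mul_mem (e_mem' _) hb_mem)) (mul_mem (e_mem' _) (star_mem hb_mem)))
          (mul_mem (e_mem' _) (mul_mem (star_mem hb_mem) hb_mem))
      · refine StarAlgebra.adjoin_le ?_
        have old : ∀ a ∈ F.loc I, a ∈ e'.range := by
          intro a haI
          obtain ⟨X, rfl⟩ := mem_e a haI
          obtain ⟨M, hM⟩ := h_e X
          exact ⟨M, hM⟩
        rintro _ ⟨i, hi, rfl⟩
        rcases Finset.mem_insert.mp (Finset.mem_coe.mp hi) with rfl | hi
        · have : F.c i = u * (u * F.c i) := by rw [← mul_assoc, h1, one_mul]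
          rw [this]
          exact mul_mem (old u hu) ⟨U, hU⟩
        · exact old _ (F.c_mem i I hi)
  obtain ⟨ι, _, _, e, he⟩ := main
  have hι : Nonempty ι := by
    by_contra h
    rw [not_nonempty_iff] at h
    have h1 : e 1 = e 0 := congrArg e (Subsingleton.elim _ _)
    rw [map_one, map_zero] at h1
    exact one_ne_zero h1
  have hinj : Function.Injective e := (e : Matrix ι ι ℂ →+* 𝒜).injective
  let r : Matrix ι ι ℂ ≃⋆ₐ[ℂ] Matrix (Fin (Fintype.card ι)) (Fin (Fintype.card ι)) ℂ :=
    { Matrix.reindexAlgEquiv ℂ ℂ (Fintype.equivFin ι) with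
      map_star' := fun M => rfl
      map_smul' := fun c M => rfl }
  exact ⟨Fintype.card ι, ⟨(he ▸ (StarAlgEquiv.ofInjective e hinj).symm).trans r⟩⟩

/-- The quasi-local system of a fermion lattice system. -/
noncomputable def toQuasiLocal [Nontrivial 𝒜] : QuasiLocal Γ 𝒜 where
  loc := F.loc
  mono := F.loc_mono
  matrix := F.loc_matrix
  dense := F.local_dense

end FermionSystem

/-! ## Entropy -/

namespace QuasiLocal

variable {Γ 𝒜 : Type*} [DecidableEq Γ] [CStarAlgebra 𝒜] (Q : QuasiLocal Γ 𝒜)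

/-- The algebra of an arbitrary (finite or infinite) region: the norm closure of the union of the
algebras of its finite subregions. -/
def region (S : Set Γ) : Set 𝒜 := closure (⋃ I ∈ {I : Finset Γ | (I : Set Γ) ⊆ S}, (Q.loc I : Set 𝒜))

/-- The support of an element: the smallest region whose algebra contains it. -/
def support (a : 𝒜) : Set Γ := ⋂₀ {S : Set Γ | a ∈ Q.region S}

/-- The matrix dimension of a local algebra. -/
noncomputable def dim (I : Finset Γ) : ℕ := (Q.matrix I).choose

/-- An identification of a local algebra with a full matrix algebra; nothing below depends on which
one is taken, since any two differ by a unitary conjugation. -/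
noncomputable def toMatrix (I : Finset Γ) :
    Q.loc I ≃⋆ₐ[ℂ] Matrix (Fin (Q.dim I)) (Fin (Q.dim I)) ℂ := (Q.matrix I).choose_spec.some

/-- The density matrix `D` of the restriction of a state to a local algebra, with respect to the
matrix trace: `D i j = ψ (e j i)` with `e` the matrix units, so that `ψ a = Tr (D a)`. -/
noncomputable def density (I : Finset Γ) (ψ : State 𝒜) :
    Matrix (Fin (Q.dim I)) (Fin (Q.dim I)) ℂ :=
  Matrix.of fun i j => ψ ((Q.toMatrix I).symm (Matrix.single j i 1) : 𝒜)

theorem trace_density (I : Finset Γ) (ψ : State 𝒜) (a : Q.loc I) :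
    (Q.density I ψ * Q.toMatrix I a).trace = ψ (a : 𝒜) := by
  let L : Matrix (Fin (Q.dim I)) (Fin (Q.dim I)) ℂ →ₗ[ℂ] ℂ :=
    { toFun := fun X => ψ ((Q.toMatrix I).symm X : 𝒜)
      map_add' := fun X Y => by rw [map_add]; exact map_add ψ.toLin _ _
      map_smul' := fun r X => by rw [map_smul]; exact map_smul ψ.toLin _ _ }
  have hL : ∀ X, L X = (Q.density I ψ * X).trace := by
    intro X
    conv_lhs => rw [Matrix.matrix_eq_sum_single X]
    have : ∀ i j, L (Matrix.single i j (X i j)) = Q.density I ψ j i * X i j := by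
      intro i j
      have e : Matrix.single i j (X i j) = X i j • Matrix.single i j (1 : ℂ) := by
        simp [Matrix.smul_single]
      rw [e, map_smul, smul_eq_mul, mul_comm]
      rfl
    simp only [map_sum, this, Matrix.trace, Matrix.diag, Matrix.mul_apply]
    exact Finset.sum_comm
  rw [← hL]
  change ψ ((Q.toMatrix I).symm (Q.toMatrix I a) : 𝒜) = ψ (a : 𝒜)
  rw [StarAlgEquiv.symm_apply_apply]

/-- The von Neumann entropy `- Tr (D log D)` of a state on a finite region, where
`Real.negMulLog x = - x log x`. -/
noncomputable def entropy (I : Finset Γ) (ψ : State 𝒜) : ℝ :=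
  (cfc Real.negMulLog (Q.density I ψ)).trace.re

/-- The conditional entropy of a finite region `I` given a (finite or infinite) region `J`, an
infimum over the finite subsets of `J`, taken in the extended reals. -/
noncomputable def condEntropy (I : Finset Γ) (J : Set Γ) (ψ : State 𝒜) : EReal :=
  ⨅ L : {L : Finset Γ // (L : Set Γ) ⊆ J},
    ((Q.entropy (I ∪ L.1) ψ - Q.entropy L.1 ψ : ℝ) : EReal)

/-- The mutual entropy between a finite region and a disjoint (finite or infinite) region. -/
noncomputable def mutualEntropy (ψ : State 𝒜) (I : Finset Γ) (J : Set Γ) : EReal :=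
  (Q.entropy I ψ : EReal) - Q.condEntropy I J ψ

end QuasiLocal

/-! ## Potentials and local thermodynamical stability -/

/-- A potential: a self-adjoint element of the algebra of `K` for every finite region `K`, such that
for every finite region `I` the sum of the terms that meet both `I` and its complement converges in
norm, as a limit over the increasing finite regions `J` of the sums of the terms inside `J`.
Translation invariance is not required. -/
structure Potential {Γ 𝒜 : Type*} [DecidableEq Γ] [CStarAlgebra 𝒜] (Q : QuasiLocal Γ 𝒜) where
  /-- the interaction of a finite region -/
  term : Finset Γ → 𝒜
  mem_loc : ∀ K, term K ∈ Q.loc K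
  selfAdjoint : ∀ K, IsSelfAdjoint (term K)
  surface_exists : ∀ I : Finset Γ, ∃ h : 𝒜, Tendsto (fun J : Finset Γ =>
    ∑ K ∈ J.powerset with (K ∩ I).Nonempty ∧ (K \ I).Nonempty, term K) atTop (𝓝 h)

namespace Potential

variable {Γ 𝒜 : Type*} [DecidableEq Γ] [CStarAlgebra 𝒜] {Q : QuasiLocal Γ 𝒜} (Φ : Potential Q)

/-- The inner Hamiltonian: the sum of the terms inside `I`. -/
noncomputable def inner (I : Finset Γ) : 𝒜 := ∑ K ∈ I.powerset, Φ.term K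

/-- The surface energy: the sum of the terms that meet both `I` and its complement. -/
noncomputable def surface (I : Finset Γ) : 𝒜 := (Φ.surface_exists I).choose

theorem tendsto_surface (I : Finset Γ) : Tendsto (fun J : Finset Γ =>
    ∑ K ∈ J.powerset with (K ∩ I).Nonempty ∧ (K \ I).Nonempty, Φ.term K) atTop
      (𝓝 (Φ.surface I)) := (Φ.surface_exists I).choose_spec

/-- The boundary of a finite region: the support of the surface energy. -/
def boundary (I : Finset Γ) : Set Γ := Q.support (Φ.surface I)

/-- The boundary area: the number of sites of the boundary, `⊤` if it is infinite. -/
noncomputable def area (I : Finset Γ) : EReal := (((Φ.boundary I).encard : ENNReal) : EReal)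

/-- The conditional free energy of a state on a finite region at inverse temperature `β`. -/
noncomputable def freeEnergy (β : ℝ) (I : Finset Γ) (ψ : State 𝒜) : EReal :=
  ((ψ (Φ.inner I + Φ.surface I)).re : EReal) -
    ((1 / β : ℝ) : EReal) * Q.condEntropy I ((I : Set Γ)ᶜ) ψ

/-- Local thermodynamical stability: for every finite region `I`, the state minimizes the
conditional free energy among all states that agree with it on the complement of `I`. -/
def IsLTS (β : ℝ) (φ : State 𝒜) : Prop :=
  ∀ (I : Finset Γ) (ψ : State 𝒜), (∀ a ∈ Q.region ((I : Set Γ)ᶜ), ψ a = φ a) →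
    Φ.freeEnergy β I φ ≤ Φ.freeEnergy β I ψ

end Potential

/-- A potential of a fermion lattice system is even if all its terms are. -/
def FermionSystem.IsEvenPotential {Γ 𝒜 : Type*} [DecidableEq Γ] [CStarAlgebra 𝒜] [Nontrivial 𝒜]
    (F : FermionSystem Γ 𝒜) (Φ : Potential F.toQuasiLocal) : Prop :=
  ∀ K : Finset Γ, F.grading (Φ.term K) = Φ.term K

end QLattice

open QLattice

/-!
The state `φ` is compared with the product `ω` of its restrictions to `𝒜(A)` and to the commutant
of `𝒜(A)`. If the restriction to `𝒜(A)` has the density matrix `D = Bᴴ B`, then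
`ω x = ∑ φ (w⋆ x w)` with the Kraus operators `w = Bᴴ eᵢⱼ`. Entropy is additive on products, so the
conditional entropy of `ω` given `Aᶜ` is at least `S_A(φ)`. As `ω` agrees with `φ` on `𝒜(Aᶜ)`,
stability gives `I_φ(A : Aᶜ) ≤ β (ω(H_A + H_∂A) - φ(H_A + H_∂A))`; the inner energies cancel, and
the surface energies differ by at most `2 ‖H_∂A‖`.

For fermions `𝒜(L)` does not commute with `𝒜(A)`. Its Jordan–Wigner copy, the image of
`b ↦ p b + (1 - p) Θ(b)` with `p` the even projection of `A`, does; it generates `𝒜(A ∪ L)` together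
with `𝒜(A)`, and an even state takes the same values on it as on `𝒜(L)`.
-/

namespace QLattice

section MatrixAlgebra

open Matrix Polynomial
open scoped Kronecker

variable {ι κ : Type*} [Fintype ι] [DecidableEq ι] [Fintype κ] [DecidableEq κ]

theorem trace_map_algEquiv {K : Type*} [Field K] (f : Matrix ι ι K ≃ₐ[K] Matrix κ κ K)
    (X : Matrix ι ι K) : (f X).trace = X.trace := by
  obtain ⟨T, hT⟩ := ((toLinAlgEquiv'.symm.trans f).trans toLinAlgEquiv').eq_linearEquivConjAlgEquiv
  have conj_eq : toLin' (f X) = T.conj (toLin' X) := by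
    have := DFunLike.congr_fun hT (toLinAlgEquiv' X)
    rwa [AlgEquiv.trans_apply, AlgEquiv.trans_apply, AlgEquiv.symm_apply_apply] at this
  rw [← trace_toLin'_eq, conj_eq, LinearMap.trace_conj', trace_toLin'_eq]

theorem sum_single_mul_mul_single {R : Type*} [CommSemiring R] (M : Matrix ι ι R) :
    ∑ p : ι × ι, single p.2 p.1 1 * M * single p.1 p.2 1 = M.trace • (1 : Matrix ι ι R) := by
  simp only [Fintype.sum_prod_type, single_mul_mul_single, one_mul, mul_one, trace, diag,
    Finset.sum_smul, ← sum_single_one, Finset.smul_sum, smul_single, smul_eq_mul]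
  exact Finset.sum_comm

variable {𝕜 : Type*} [RCLike 𝕜]

theorem trace_cfc_map_starAlgEquiv (e : Matrix ι ι 𝕜 ≃⋆ₐ[𝕜] Matrix κ κ 𝕜) {f : ℝ → ℝ}
    (hf : Continuous f) {M : Matrix ι ι 𝕜} (hM : M.IsHermitian) :
    (cfc f (e M)).trace = (cfc f M).trace := by
  have continuous_e : Continuous e :=
    (e.toAlgEquiv.toLinearMap : Matrix ι ι 𝕜 →ₗ[𝕜] Matrix κ κ 𝕜).continuous_of_finiteDimensional
  rw [← StarAlgHomClass.map_cfc (S := 𝕜) e f M hf.continuousOn continuous_e hM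
    (IsSelfAdjoint.map hM e)]
  exact trace_map_algEquiv e.toAlgEquiv _

theorem trace_cfc_eq_sum_of_charpoly_eq {M : Matrix ι ι 𝕜} (hM : M.IsHermitian) (f : ℝ → ℝ)
    {τ : Type*} [Fintype τ] (d : τ → ℝ) (h : M.charpoly = ∏ i, (X - C (d i : 𝕜))) :
    (cfc f M).trace = ∑ i, (f (d i) : 𝕜) := by
  have trace_cfc : (cfc f M).trace = ∑ i, (f (hM.eigenvalues i) : 𝕜) := by
    rw [hM.cfc_eq, IsHermitian.cfc, Unitary.conjStarAlgAut_apply, trace_mul_comm, ← mul_assoc]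
    simp [trace_diagonal]
  have roots_eq : Finset.univ.val.map (fun i => (d i : 𝕜)) =
      Finset.univ.val.map fun i => (hM.eigenvalues i : 𝕜) := by
    simpa [h, roots_prod, Finset.prod_ne_zero_iff, X_sub_C_ne_zero, Function.comp_def] using
      hM.roots_charpoly_eq_eigenvalues
  rw [trace_cfc]
  simpa using
    congrArg (fun s : Multiset 𝕜 => (s.map fun z => (f (RCLike.re z) : 𝕜)).sum) roots_eq.symm

theorem charpoly_kronecker {A : Matrix ι ι 𝕜} {B : Matrix κ κ 𝕜} (hA : A.IsHermitian)
    (hB : B.IsHermitian) : (A ⊗ₖ B).charpoly =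
      ∏ p : ι × κ, (X - C ((hA.eigenvalues p.1 * hB.eigenvalues p.2 : ℝ) : 𝕜)) := by
  set U := (hA.eigenvectorUnitary : Matrix ι ι 𝕜)
  set V := (hB.eigenvectorUnitary : Matrix κ κ 𝕜)
  set a : ι → 𝕜 := fun i => hA.eigenvalues i
  set b : κ → 𝕜 := fun i => hB.eigenvalues i
  have hA' : A = U * diagonal a * star U := hA.spectral_theorem
  have hB' : B = V * diagonal b * star V := hB.spectral_theorem
  have diagonalize : A ⊗ₖ B = (U ⊗ₖ V) * (diagonal a ⊗ₖ diagonal b) * (star U ⊗ₖ star V) := by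
    rw [← mul_kronecker_mul, ← mul_kronecker_mul, ← hA', ← hB']
  rw [diagonalize, charpoly_mul_comm, ← mul_assoc, ← mul_kronecker_mul]
  simp [U, V, a, b, diagonal_kronecker_diagonal, charpoly_diagonal]

theorem trace_cfc_negMulLog_kronecker {A : Matrix ι ι 𝕜} {B : Matrix κ κ 𝕜} (hA : A.IsHermitian)
    (hB : B.IsHermitian) :
    (cfc Real.negMulLog (A ⊗ₖ B)).trace =
      (cfc Real.negMulLog A).trace * B.trace + A.trace * (cfc Real.negMulLog B).trace := by
  have hAB : (A ⊗ₖ B).IsHermitian := by rw [IsHermitian, conjTranspose_kronecker, hA.eq, hB.eq]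
  rw [trace_cfc_eq_sum_of_charpoly_eq hAB _ _ (charpoly_kronecker hA hB),
    trace_cfc_eq_sum_of_charpoly_eq hA _ _ hA.charpoly_eq,
    trace_cfc_eq_sum_of_charpoly_eq hB _ _ hB.charpoly_eq, hA.trace_eq_sum_eigenvalues,
    hB.trace_eq_sum_eigenvalues, Finset.sum_mul_sum, Finset.sum_mul_sum, Fintype.sum_prod_type]
  simp only [← Finset.sum_add_distrib, Real.negMulLog_mul]
  refine Finset.sum_congr rfl fun i _ => Finset.sum_congr rfl fun j _ => ?_
  push_cast
  ring

theorem kronecker_induction {ι κ R : Type*} [Finite ι] [Finite κ] [CommSemiring R]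
    {p : Matrix (ι × κ) (ι × κ) R → Prop} (kronecker : ∀ X Y, p (X ⊗ₖ Y))
    (add : ∀ M N, p M → p N → p (M + N)) (M) : p M := by
  classical
  cases nonempty_fintype ι
  cases nonempty_fintype κ
  obtain ⟨x, rfl⟩ := (kroneckerAlgEquiv ι κ R).surjective M
  induction x with
  | zero => simpa using kronecker 0 0
  | tmul X Y => simpa using kronecker X Y
  | add x y hx hy => simpa using add _ _ hx hy

section KroneckerLift

variable {R 𝒜 : Type*} [CommRing R] [StarRing R] [Ring 𝒜] [StarRing 𝒜] [Algebra R 𝒜]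
  (π₁ : Matrix ι ι R →⋆ₐ[R] 𝒜) (π₂ : Matrix κ κ R →⋆ₐ[R] 𝒜) (hc : ∀ X Y, Commute (π₁ X) (π₂ Y))

/-- The representation `X ⊗ₖ Y ↦ π₁ X * π₂ Y` of the tensor product of two matrix algebras
determined by commuting representations of the factors. -/
noncomputable def kroneckerLift : Matrix (ι × κ) (ι × κ) R →⋆ₐ[R] 𝒜 :=
  let lift := (Algebra.TensorProduct.lift π₁.toAlgHom π₂.toAlgHom hc).comp
    (kroneckerAlgEquiv ι κ R).symm.toAlgHom
  { lift with
    map_star' M := by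
      have lift_kronecker (X Y) : lift (X ⊗ₖ Y) = π₁ X * π₂ Y := by simp [lift]
      change lift (star M) = star (lift M)
      induction M using kronecker_induction with
      | kronecker X Y =>
        rw [star_eq_conjTranspose, conjTranspose_kronecker, lift_kronecker, lift_kronecker,
          ← star_eq_conjTranspose, ← star_eq_conjTranspose, (hc _ _).eq, map_star, map_star,
          star_mul]
      | add M N hM hN => rw [star_add, map_add, map_add, star_add, hM, hN] }

theorem kroneckerLift_kronecker (X : Matrix ι ι R) (Y : Matrix κ κ R) :
    kroneckerLift π₁ π₂ hc (X ⊗ₖ Y) = π₁ X * π₂ Y := by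
  change ((Algebra.TensorProduct.lift π₁.toAlgHom π₂.toAlgHom hc).comp
    (kroneckerAlgEquiv ι κ R).symm.toAlgHom) (X ⊗ₖ Y) = _
  simp

theorem range_kroneckerLift [StarModule R 𝒜] :
    (kroneckerLift π₁ π₂ hc).range = π₁.range ⊔ π₂.range := by
  refine le_antisymm ?_ (sup_le ?_ ?_)
  · rintro _ ⟨M, rfl⟩
    change kroneckerLift π₁ π₂ hc M ∈ π₁.range ⊔ π₂.range
    induction M using kronecker_induction with
    | kronecker X Y =>
      rw [kroneckerLift_kronecker]
      exact mul_mem ((le_sup_left : π₁.range ≤ _) ⟨X, rfl⟩)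
        ((le_sup_right : π₂.range ≤ _) ⟨Y, rfl⟩)
    | add M N hM hN =>
      rw [map_add]
      exact add_mem hM hN
  · rintro _ ⟨X, rfl⟩
    exact ⟨X ⊗ₖ 1, by simpa using kroneckerLift_kronecker π₁ π₂ hc X 1⟩
  · rintro _ ⟨Y, rfl⟩
    exact ⟨1 ⊗ₖ Y, by simpa using kroneckerLift_kronecker π₁ π₂ hc 1 Y⟩

end KroneckerLift

end MatrixAlgebra

theorem mem_centralizer_adjoin_iff {R ℬ : Type*} [CommSemiring R] [StarRing R] [Semiring ℬ]
    [StarRing ℬ] [Algebra R ℬ] [StarModule R ℬ] {s : Set ℬ} {z : ℬ} :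
    z ∈ StarSubalgebra.centralizer R (StarAlgebra.adjoin R s : Set ℬ) ↔
      z ∈ StarSubalgebra.centralizer R s := by
  refine ⟨fun h => StarSubalgebra.centralizer_le R _ _ (StarAlgebra.subset_adjoin R s) h,
    fun h => (StarSubalgebra.mem_centralizer_iff R).mpr fun g hg => ?_⟩
  have commute {g} (hg : g ∈ StarAlgebra.adjoin R s) : g * z = z * g :=
    (((StarSubalgebra.mem_centralizer_iff R).mp
      (StarAlgebra.adjoin_le_centralizer_centralizer R s hg)) z h).1.symm
  exact ⟨commute hg, commute (star_mem hg)⟩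

theorem range_le_of_forall_mem {R ℬ 𝒞 : Type*} [CommSemiring R] [StarRing R] [Semiring ℬ]
    [StarRing ℬ] [Algebra R ℬ] [StarModule R ℬ] [Semiring 𝒞] [StarRing 𝒞] [Algebra R 𝒞]
    [StarModule R 𝒞] {s : Set ℬ} (f : StarAlgebra.adjoin R s →⋆ₐ[R] 𝒞) {T : StarSubalgebra R 𝒞}
    (h : ∀ x (hx : x ∈ s), f ⟨x, StarAlgebra.subset_adjoin R s hx⟩ ∈ T) : f.range ≤ T := by
  rintro _ ⟨b, rfl⟩
  change b ∈ T.comap f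
  exact StarAlgebra.adjoin_induction_subtype b h (algebraMap_mem _) (fun _ _ => add_mem)
    (fun _ _ => mul_mem) (fun _ => star_mem)

section Piecewise

variable {R ℬ 𝒞 : Type*} [CommSemiring R] [Semiring ℬ] [StarRing ℬ] [Algebra R ℬ]
  [Ring 𝒞] [StarRing 𝒞] [Algebra R 𝒞]

/-- The representation that is `f` on the range of the projection `p` and `g` on its complement. -/
def piecewiseStarAlgHom {p : 𝒞} (hp : IsStarProjection p) (f g : ℬ →⋆ₐ[R] 𝒞)
    (hf : ∀ b, Commute p (f b)) (hg : ∀ b, Commute p (g b)) : ℬ →⋆ₐ[R] 𝒞 where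
  toFun b := p * f b + (1 - p) * g b
  map_one' := by simp
  map_zero' := by simp
  map_add' x y := by rw [map_add, map_add, mul_add, mul_add, add_add_add_comm]
  map_mul' x y := by
    have hpp := hp.isIdempotentElem
    have hf' := (Commute.one_right _).sub_right (hf x).symm
    have hg' := (Commute.one_right _).sub_right (hg x).symm
    rw [mul_add, add_mul, add_mul, (hf x).symm.mul_mul_mul_comm, (hg x).symm.mul_mul_mul_comm,
      hf'.mul_mul_mul_comm, hg'.mul_mul_mul_comm, hpp.eq, hpp.one_sub.eq, hpp.mul_one_sub_self,
      hpp.one_sub_mul_self, zero_mul, zero_mul, add_zero, zero_add, map_mul, map_mul]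
  map_star' x := by
    have hg' := (Commute.one_left _).sub_left (hg (star x))
    rw [star_add, star_mul, star_mul, hp.isSelfAdjoint.star_eq, hp.one_sub.isSelfAdjoint.star_eq,
      ← map_star, ← map_star, (hf _).eq, hg'.eq]
  commutes' r := by simp [AlgHomClass.commutes, ← add_mul]

end Piecewise

theorem coe_sub_le_of_coe_sub_mul_le {β s e₁ e₂ : ℝ} (hβ : 0 < β) {C C' : EReal}
    (hs : (s : EReal) ≤ C')
    (h : (e₁ : EReal) - ((1 / β : ℝ) : EReal) * C ≤ e₂ - ((1 / β : ℝ) : EReal) * C') :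
    (s : EReal) - C ≤ ((β * (e₂ - e₁) : ℝ) : EReal) := by
  have hpos : 0 < 1 / β := by positivity
  have h' : (e₁ : EReal) - ((1 / β : ℝ) : EReal) * C ≤ ((e₂ - 1 / β * s : ℝ) : EReal) := by
    refine h.trans ?_
    rw [EReal.coe_sub, EReal.coe_mul]
    exact EReal.sub_le_sub le_rfl
      (mul_le_mul_of_nonneg_left hs (EReal.coe_nonneg.mpr hpos.le))
  induction C with
  | bot =>
    rw [EReal.coe_mul_bot_of_pos hpos, EReal.coe_sub_bot, top_le_iff] at h'
    exact absurd h' (EReal.coe_ne_top _)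
  | top => simp
  | coe C =>
    norm_cast at h' ⊢
    have : β * (e₁ - 1 / β * C) ≤ β * (e₂ - 1 / β * s) := mul_le_mul_of_nonneg_left h' hβ.le
    field_simp at this
    linarith

variable {Γ 𝒜 : Type*} [CStarAlgebra 𝒜]

namespace State

section Bounds

variable (ψ : State 𝒜)

theorem nonneg_apply [PartialOrder 𝒜] [StarOrderedRing 𝒜] {a : 𝒜} (ha : 0 ≤ a) : 0 ≤ ψ a := by
  obtain ⟨b, rfl⟩ := CStarAlgebra.nonneg_iff_eq_star_mul_self.mp ha
  exact ψ.nonneg b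

theorem continuous : Continuous ψ.toLin := by
  let := CStarAlgebra.spectralOrder 𝒜
  have := CStarAlgebra.spectralOrderedRing 𝒜
  exact map_continuous (PositiveLinearMap.mk₀ ψ.toLin fun x hx => ψ.nonneg_apply hx)

theorem apply_star (a : 𝒜) : ψ (star a) = star (ψ a) := by
  let := CStarAlgebra.spectralOrder 𝒜
  have := CStarAlgebra.spectralOrderedRing 𝒜
  exact map_star (PositiveLinearMap.mk₀ ψ.toLin fun x hx => ψ.nonneg_apply hx) a

theorem re_apply_le_norm {a : 𝒜} (ha : IsSelfAdjoint a) : (ψ a).re ≤ ‖a‖ := by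
  let := CStarAlgebra.spectralOrder 𝒜
  have := CStarAlgebra.spectralOrderedRing 𝒜
  have h := ψ.nonneg_apply (sub_nonneg.mpr ha.le_algebraMap_norm_self)
  rw [IsScalarTower.algebraMap_apply ℝ ℂ 𝒜, Algebra.algebraMap_eq_smul_one, map_sub, map_smul,
    ψ.map_one, smul_eq_mul, mul_one, Complex.le_def] at h
  simpa using h.1

theorem re_apply_sub_re_apply_le (φ : State 𝒜) {a : 𝒜} (ha : IsSelfAdjoint a) :
    (ψ a).re - (φ a).re ≤ 2 * ‖a‖ := by
  have h := φ.re_apply_le_norm ha.neg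
  rw [map_neg, norm_neg, Complex.neg_re] at h
  linarith [ψ.re_apply_le_norm ha]

end Bounds

section MatrixDensity

open Matrix

variable {ι κ : Type*} [Fintype ι] [DecidableEq ι] [Fintype κ] [DecidableEq κ] (ψ : State 𝒜)
  (π : Matrix ι ι ℂ →⋆ₐ[ℂ] 𝒜)

/-- The density matrix of a state in a representation `π` of a matrix algebra: the matrix `D` such
that `ψ (π X) = Tr (D X)`. -/
noncomputable def matrixDensity : Matrix ι ι ℂ := .of fun i j => ψ (π (single j i 1))

theorem trace_matrixDensity_mul (X : Matrix ι ι ℂ) :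
    (ψ.matrixDensity π * X).trace = ψ (π X) := by
  have entry (i j : ι) : ψ (π (single i j (X i j))) = ψ.matrixDensity π j i * X i j := by
    rw [← mul_one (X i j), ← smul_eq_mul, ← smul_single, map_smul, map_smul, smul_eq_mul,
      smul_eq_mul, mul_one, mul_comm, matrixDensity, of_apply]
  conv_rhs => rw [matrix_eq_sum_single X]
  simp only [map_sum, entry, trace, diag, mul_apply]
  exact Finset.sum_comm

theorem eq_matrixDensity {D : Matrix ι ι ℂ} (hD : ∀ X, (D * X).trace = ψ (π X)) :
    D = ψ.matrixDensity π :=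
  ext_iff_trace_mul_right.mpr fun X => by rw [hD, trace_matrixDensity_mul]

theorem matrixDensity_comp_symm (e : Matrix ι ι ℂ ≃⋆ₐ[ℂ] Matrix κ κ ℂ) :
    ψ.matrixDensity (π.comp (e.symm : Matrix κ κ ℂ →⋆ₐ[ℂ] Matrix ι ι ℂ)) =
      e (ψ.matrixDensity π) := by
  refine (eq_matrixDensity ψ _ fun Y => ?_).symm
  obtain ⟨X, rfl⟩ := e.surjective Y
  calc (e (ψ.matrixDensity π) * e X).trace = (e (ψ.matrixDensity π * X)).trace := by rw [map_mul]
    _ = (ψ.matrixDensity π * X).trace := trace_map_algEquiv e.toAlgEquiv _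
    _ = ψ (π (e.symm (e X))) := by rw [trace_matrixDensity_mul, e.symm_apply_apply]

theorem trace_matrixDensity : (ψ.matrixDensity π).trace = 1 := by
  rw [← mul_one (ψ.matrixDensity π), trace_matrixDensity_mul, _root_.map_one, ψ.map_one]

theorem isHermitian_matrixDensity : (ψ.matrixDensity π).IsHermitian := by
  ext i j
  change star (ψ (π (single i j 1))) = ψ (π (single j i 1))
  rw [← ψ.apply_star, ← map_star π, star_eq_conjTranspose, conjTranspose_single, star_one]

theorem posSemidef_matrixDensity : (ψ.matrixDensity π).PosSemidef := by
  refine .of_dotProduct_mulVec_nonneg (ψ.isHermitian_matrixDensity π) fun x => ?_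
  rcases isEmpty_or_nonempty ι with _ | ⟨⟨i₀⟩⟩
  · simp
  let Y : Matrix ι ι ℂ := vecMulVec (Pi.single i₀ 1) (star x)
  have star_Y_mul_Y : star Y * Y = vecMulVec x (star x) := by
    simp [Y, star_eq_conjTranspose, conjTranspose_vecMulVec, vecMulVec_mul_vecMulVec]
  have h := ψ.nonneg (π Y)
  rwa [← map_star π, ← map_mul, star_Y_mul_Y, ← trace_matrixDensity_mul, mul_vecMulVec,
    trace_vecMulVec, dotProduct_comm] at h

open scoped MatrixOrder Matrix.Norms.L2Operator in
theorem exists_matrixDensity_eq_conjTranspose_mul_self : ∃ B, ψ.matrixDensity π = Bᴴ * B :=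
  CStarAlgebra.nonneg_iff_eq_star_mul_self.mp (ψ.posSemidef_matrixDensity π).nonneg

include ψ in
theorem injective_rep : Function.Injective π := by
  have : Nontrivial 𝒜 := ⟨1, 0, fun h => by simpa [h] using ψ.map_one⟩
  have : Nontrivial (Matrix ι ι ℂ) := (π : Matrix ι ι ℂ →+* 𝒜).domain_nontrivial
  have : Nonempty ι := by
    by_contra h
    rw [not_nonempty_iff] at h
    exact not_subsingleton (Matrix ι ι ℂ) inferInstance
  exact (π : Matrix ι ι ℂ →+* 𝒜).injective

end MatrixDensity

section Product

open Matrix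

/-- The state `x ↦ ∑ k, ψ (w k⋆ * x * w k)` with Kraus operators `w`. -/
noncomputable def kraus (ψ : State 𝒜) {κ : Type*} [Fintype κ] (w : κ → 𝒜)
    (hw : ψ (∑ k, star (w k) * w k) = 1) : State 𝒜 where
  toLin := ψ.toLin ∘ₗ ∑ k, LinearMap.mulLeftRight ℂ (star (w k), w k)
  nonneg a := by
    simp only [LinearMap.comp_apply, LinearMap.sum_apply, LinearMap.mulLeftRight_apply, map_sum]
    refine Finset.sum_nonneg fun k _ => ?_
    simpa only [star_mul, mul_assoc] using ψ.nonneg (a * w k)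
  map_one := by simpa using hw

/-- `ω` is the product of the restrictions of `ψ` to the subalgebra `S` and to its commutant. -/
def IsProduct (ψ : State 𝒜) (S : StarSubalgebra ℂ 𝒜) (ω : State 𝒜) : Prop :=
  ∀ a ∈ S, ∀ b ∈ StarSubalgebra.centralizer ℂ (S : Set 𝒜), ω (a * b) = ψ a * ψ b

theorem IsProduct.apply_of_mem {ψ ω : State 𝒜} {S : StarSubalgebra ℂ 𝒜} (h : ψ.IsProduct S ω)
    {a : 𝒜} (ha : a ∈ S) : ω a = ψ a := by
  simpa [ψ.map_one] using h a ha 1 (one_mem _)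

theorem IsProduct.apply_of_mem_centralizer {ψ ω : State 𝒜} {S : StarSubalgebra ℂ 𝒜}
    (h : ψ.IsProduct S ω) {b : 𝒜} (hb : b ∈ StarSubalgebra.centralizer ℂ (S : Set 𝒜)) :
    ω b = ψ b := by
  simpa [ψ.map_one] using h 1 (one_mem _) b hb

variable {ι : Type*} [Fintype ι] [DecidableEq ι]

theorem sum_star_mul_mul_single (π : Matrix ι ι ℂ →⋆ₐ[ℂ] 𝒜) (B X : Matrix ι ι ℂ) {b : 𝒜}
    (hb : ∀ Y, Commute (π Y) b) :
    ∑ p : ι × ι, star (π (Bᴴ * single p.1 p.2 1)) * (π X * b) * π (Bᴴ * single p.1 p.2 1) =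
      (Bᴴ * B * X).trace • b := by
  have move_b (p : ι × ι) :
      star (π (Bᴴ * single p.1 p.2 1)) * (π X * b) * π (Bᴴ * single p.1 p.2 1) =
        π (single p.2 p.1 1 * (B * X * Bᴴ) * single p.1 p.2 1) * b := by
    rw [← map_star, star_eq_conjTranspose, conjTranspose_mul, conjTranspose_conjTranspose,
      conjTranspose_single, star_one, mul_assoc, mul_assoc, ← (hb _).eq]
    simp only [map_mul, mul_assoc]
  rw [Finset.sum_congr rfl fun p _ => move_b p, ← Finset.sum_mul, ← map_sum,
    sum_single_mul_mul_single, trace_mul_comm, ← mul_assoc, map_smul, _root_.map_one,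
    smul_one_mul]

theorem exists_isProduct (ψ : State 𝒜) (π : Matrix ι ι ℂ →⋆ₐ[ℂ] 𝒜) :
    ∃ ω : State 𝒜, ψ.IsProduct π.range ω := by
  obtain ⟨B, hB⟩ := ψ.exists_matrixDensity_eq_conjTranspose_mul_self π
  let w (p : ι × ι) : 𝒜 := π (Bᴴ * single p.1 p.2 1)
  have sum_w {b : 𝒜} (X) (hb : ∀ Y, Commute (π Y) b) :
      ∑ p, star (w p) * (π X * b) * w p = ψ (π X) • b := by
    rw [sum_star_mul_mul_single π B X hb, ← hB, trace_matrixDensity_mul]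
  have map_one_eq : ψ (∑ p, star (w p) * w p) = 1 := by
    have := sum_w 1 fun Y => Commute.one_right (π Y)
    simp only [_root_.map_one, mul_one, ψ.map_one, one_smul] at this
    rw [this, ψ.map_one]
  refine ⟨ψ.kraus w map_one_eq, ?_⟩
  rintro _ ⟨X, rfl⟩ b hb
  have := sum_w X fun Y => ((StarSubalgebra.mem_centralizer_iff ℂ).mp hb (π Y) ⟨Y, rfl⟩).1
  simpa [kraus] using congrArg ψ.toLin this

end Product

end State

namespace QuasiLocal

section Representation

variable {Q : QuasiLocal Γ 𝒜}

/-- A representation of a local algebra, as a representation of the matrix algebra with which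
`Q.toMatrix` identifies it. -/
noncomputable def matrixRep {I : Finset Γ} (θ : Q.loc I →⋆ₐ[ℂ] 𝒜) :
    Matrix (Fin (Q.dim I)) (Fin (Q.dim I)) ℂ →⋆ₐ[ℂ] 𝒜 :=
  θ.comp ((Q.toMatrix I).symm : _ →⋆ₐ[ℂ] _)

theorem range_matrixRep {I : Finset Γ} (θ : Q.loc I →⋆ₐ[ℂ] 𝒜) : (matrixRep θ).range = θ.range :=
  SetLike.coe_injective ((Q.toMatrix I).symm.surjective.range_comp θ)

variable (Q) in
/-- The inclusion of a local algebra, as a representation of the matrix algebra; `Q.density` is the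
density matrix in this representation. -/
noncomputable def rep (I : Finset Γ) : Matrix (Fin (Q.dim I)) (Fin (Q.dim I)) ℂ →⋆ₐ[ℂ] 𝒜 :=
  matrixRep (Q.loc I).subtype

variable (Q) in
theorem range_rep (I : Finset Γ) : (Q.rep I).range = Q.loc I :=
  (range_matrixRep _).trans (SetLike.coe_injective Subtype.range_val)

theorem entropy_eq_of_range_eq {ι : Type*} [Fintype ι] [DecidableEq ι] {I : Finset Γ}
    (ψ : State 𝒜) {π : Matrix ι ι ℂ →⋆ₐ[ℂ] 𝒜} (hπ : π.range = Q.loc I) :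
    Q.entropy I ψ = (cfc Real.negMulLog (ψ.matrixDensity π)).trace.re := by
  have mem_loc (X) : π X ∈ Q.loc I := hπ ▸ ⟨X, rfl⟩
  have bijective : Function.Bijective (π.codRestrict (Q.loc I) mem_loc) :=
    ⟨fun X Y h => ψ.injective_rep π (congrArg Subtype.val h), fun ⟨a, ha⟩ => by
      obtain ⟨X, hX⟩ : a ∈ π.range := hπ ▸ ha
      exact ⟨X, Subtype.ext hX⟩⟩
  let e := (StarAlgEquiv.ofBijective _ bijective).trans (Q.toMatrix I)
  have rep_eq : Q.rep I = π.comp (e.symm : _ →⋆ₐ[ℂ] Matrix ι ι ℂ) := by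
    ext Y
    obtain ⟨X, rfl⟩ := e.surjective Y
    change ((Q.toMatrix I).symm (Q.toMatrix I ⟨π X, mem_loc X⟩)).1 = π (e.symm (e X))
    rw [StarAlgEquiv.symm_apply_apply, StarAlgEquiv.symm_apply_apply]
  have density_eq : Q.density I ψ = e (ψ.matrixDensity π) := by
    rw [← State.matrixDensity_comp_symm, ← rep_eq]
    rfl
  rw [entropy, density_eq,
    trace_cfc_map_starAlgEquiv e Real.continuous_negMulLog (ψ.isHermitian_matrixDensity π)]

theorem entropy_congr {I : Finset Γ} {ψ ω : State 𝒜} (h : ∀ a ∈ Q.loc I, ω a = ψ a) :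
    Q.entropy I ω = Q.entropy I ψ := by
  have : Q.density I ω = Q.density I ψ := by
    ext i j
    exact h _ (SetLike.coe_mem _)
  rw [entropy, entropy, this]

theorem condEntropy_anti [DecidableEq Γ] (I : Finset Γ) {J K : Set Γ} (h : J ⊆ K) (ψ : State 𝒜) :
    Q.condEntropy I K ψ ≤ Q.condEntropy I J ψ :=
  le_iInf fun L => iInf_le_of_le ⟨L.1, L.2.trans h⟩ le_rfl

end Representation

variable [DecidableEq Γ] {Q : QuasiLocal Γ 𝒜}

/-- `θ` exhibits `𝒜(A ∪ L)` as the tensor product of `𝒜(A)` and of a copy of `𝒜(L)` on which `φ`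
has the same values. The field `apply_eq_of_isProduct` says that the original `𝒜(L)`, which need
not commute with `𝒜(A)`, cannot tell a product state apart from `φ` either. -/
structure IsSplitting (Q : QuasiLocal Γ 𝒜) (φ : State 𝒜) (A L : Finset Γ)
    (θ : Q.loc L →⋆ₐ[ℂ] 𝒜) : Prop where
  range_le_centralizer : θ.range ≤ StarSubalgebra.centralizer ℂ (Q.loc A : Set 𝒜)
  apply_eq : ∀ b, φ (θ b) = φ (b : 𝒜)
  sup_range : Q.loc A ⊔ θ.range = Q.loc (A ∪ L)
  apply_eq_of_isProduct : ∀ ω, φ.IsProduct (Q.loc A) ω → ∀ b ∈ Q.loc L, ω b = φ b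

theorem IsSplitting.entropy_union {φ ω : State 𝒜} {A L : Finset Γ} {θ : Q.loc L →⋆ₐ[ℂ] 𝒜}
    (hθ : Q.IsSplitting φ A L θ) (hω : φ.IsProduct (Q.loc A) ω) :
    Q.entropy (A ∪ L) ω = Q.entropy A φ + Q.entropy L φ := by
  let ρ := matrixRep θ
  have rep_mem (X) : Q.rep A X ∈ Q.loc A := Q.range_rep A ▸ ⟨X, rfl⟩
  have ρ_mem (Y) : ρ Y ∈ StarSubalgebra.centralizer ℂ (Q.loc A : Set 𝒜) :=
    hθ.range_le_centralizer ⟨_, rfl⟩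
  have commute (X Y) : Commute (Q.rep A X) (ρ Y) :=
    ((StarSubalgebra.mem_centralizer_iff ℂ).mp (ρ_mem Y) _ (rep_mem X)).1
  have range_eq : (kroneckerLift (Q.rep A) ρ commute).range = Q.loc (A ∪ L) := by
    rw [range_kroneckerLift, range_rep, range_matrixRep, hθ.sup_range]
  have density_eq : Matrix.kroneckerMap (· * ·) (φ.matrixDensity (Q.rep A)) (φ.matrixDensity ρ) =
      ω.matrixDensity (kroneckerLift (Q.rep A) ρ commute) := by
    refine State.eq_matrixDensity _ _ fun M => ?_
    induction M using kronecker_induction with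
    | kronecker X Y =>
      rw [kroneckerLift_kronecker, hω _ (rep_mem X) _ (ρ_mem Y), ← Matrix.mul_kronecker_mul,
        Matrix.trace_kronecker, State.trace_matrixDensity_mul, State.trace_matrixDensity_mul]
    | add M N hM hN => rw [mul_add, Matrix.trace_add, hM, hN, map_add, map_add]
  have density_L : Q.density L φ = φ.matrixDensity ρ := by
    ext i j
    exact (hθ.apply_eq _).symm
  rw [entropy_eq_of_range_eq ω range_eq, ← density_eq, trace_cfc_negMulLog_kronecker
    (φ.isHermitian_matrixDensity _) (φ.isHermitian_matrixDensity _), φ.trace_matrixDensity,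
    φ.trace_matrixDensity, mul_one, one_mul, Complex.add_re, ← density_L]
  rfl

theorem le_condEntropy_of_isProduct {φ ω : State 𝒜} {A : Finset Γ}
    (h : ∀ L, Disjoint A L → ∃ θ, Q.IsSplitting φ A L θ) (hω : φ.IsProduct (Q.loc A) ω) :
    (Q.entropy A φ : EReal) ≤ Q.condEntropy A (A : Set Γ)ᶜ ω := by
  refine le_iInf fun ⟨L, hL⟩ => ?_
  obtain ⟨θ, hθ⟩ := h L (Finset.disjoint_coe.mp (Set.subset_compl_iff_disjoint_left.mp hL))
  rw [hθ.entropy_union hω, entropy_congr (hθ.apply_eq_of_isProduct ω hω), add_sub_cancel_right]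

theorem apply_eq_of_isProduct_of_mem_region {φ ω : State 𝒜} {A : Finset Γ}
    (h : ∀ L, Disjoint A L → ∃ θ, Q.IsSplitting φ A L θ) (hω : φ.IsProduct (Q.loc A) ω)
    {a : 𝒜} (ha : a ∈ Q.region (A : Set Γ)ᶜ) : ω a = φ a := by
  refine closure_minimal (t := {a | ω a = φ a}) ?_ (isClosed_eq ω.continuous φ.continuous) ha
  refine Set.iUnion₂_subset fun L hL b hb => ?_
  obtain ⟨θ, hθ⟩ := h L (Finset.disjoint_coe.mp (Set.subset_compl_iff_disjoint_left.mp hL))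
  exact hθ.apply_eq_of_isProduct ω hω b hb

end QuasiLocal

section AreaLaw

variable [DecidableEq Γ] {Q : QuasiLocal Γ 𝒜} (Φ : Potential Q)

theorem Potential.inner_mem (I : Finset Γ) : Φ.inner I ∈ Q.loc I :=
  sum_mem fun K hK => Q.mono K I (Finset.mem_powerset.mp hK) (Φ.mem_loc K)

theorem Potential.isSelfAdjoint_surface (I : Finset Γ) : IsSelfAdjoint (Φ.surface I) :=
  (isClosed_eq continuous_star continuous_id).mem_of_tendsto (Φ.tendsto_surface I)
    (Eventually.of_forall fun _ =>
      AddSubgroup.sum_mem (_root_.selfAdjoint 𝒜) fun K _ => Φ.selfAdjoint K)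

variable {Φ}

theorem mutualEntropy_le_of_isSplitting {β : ℝ} (hβ : 0 < β) {φ : State 𝒜} {A : Finset Γ}
    (hsplit : ∀ L, Disjoint A L → ∃ θ, Q.IsSplitting φ A L θ)
    (hmin : ∀ ψ : State 𝒜, (∀ a ∈ Q.region (A : Set Γ)ᶜ, ψ a = φ a) →
      Φ.freeEnergy β A φ ≤ Φ.freeEnergy β A ψ) {B : Set Γ} (hB : Disjoint (A : Set Γ) B) :
    Q.mutualEntropy φ A B ≤ ((2 * β * ‖Φ.surface A‖ : ℝ) : EReal) := by
  obtain ⟨ω, hω⟩ := φ.exists_isProduct (Q.rep A)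
  rw [Q.range_rep] at hω
  have energy_sub_le :
      (ω (Φ.inner A + Φ.surface A)).re - (φ (Φ.inner A + Φ.surface A)).re ≤
        2 * ‖Φ.surface A‖ := by
    rw [map_add, map_add, hω.apply_of_mem (Φ.inner_mem A), Complex.add_re, Complex.add_re,
      add_sub_add_left_eq_sub]
    exact ω.re_apply_sub_re_apply_le φ (Φ.isSelfAdjoint_surface A)
  calc Q.mutualEntropy φ A B
      ≤ Q.entropy A φ - Q.condEntropy A (A : Set Γ)ᶜ φ :=
        EReal.sub_le_sub le_rfl
          (QuasiLocal.condEntropy_anti A (Set.subset_compl_iff_disjoint_left.mpr hB) φ)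
    _ ≤ _ := coe_sub_le_of_coe_sub_mul_le hβ (QuasiLocal.le_condEntropy_of_isProduct hsplit hω)
        (hmin ω fun _ => QuasiLocal.apply_eq_of_isProduct_of_mem_region hsplit hω)
    _ ≤ ((2 * β * ‖Φ.surface A‖ : ℝ) : EReal) := by
        rw [mul_comm 2 β, mul_assoc]
        exact EReal.coe_le_coe_iff.mpr (mul_le_mul_of_nonneg_left energy_sub_le hβ.le)

end AreaLaw

theorem SpinSystem.exists_isSplitting [DecidableEq Γ] (S : SpinSystem Γ 𝒜) (φ : State 𝒜)
    {A L : Finset Γ} (h : Disjoint A L) : ∃ θ, S.toQuasiLocal.IsSplitting φ A L θ := by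
  have loc_le : S.loc L ≤ StarSubalgebra.centralizer ℂ (S.loc A : Set 𝒜) := fun b hb =>
    (StarSubalgebra.mem_centralizer_iff ℂ).mpr fun a ha =>
      ⟨S.commute A L h a ha b hb, S.commute A L h _ (star_mem ha) b hb⟩
  have range_subtype : (S.loc L).subtype.range = S.loc L := SetLike.coe_injective Subtype.range_val
  exact ⟨(S.loc L).subtype, {
    range_le_centralizer := range_subtype.trans_le loc_le
    apply_eq := fun _ => rfl
    sup_range := by rw [range_subtype, S.sup A L h]
    apply_eq_of_isProduct := fun ω hω b hb => hω.apply_of_mem_centralizer (loc_le hb) }⟩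

namespace FermionSystem

variable [DecidableEq Γ] (F : FermionSystem Γ 𝒜) {A L I : Finset Γ}

/-- The parity operator of a finite region, which is `-1` to the number of particles in it. -/
noncomputable def parity (I : Finset Γ) : 𝒜 := (F.exists_parity I).choose

theorem parity_mem_loc (I : Finset Γ) : F.parity I ∈ F.loc I := (F.exists_parity I).choose_spec.1

theorem star_parity (I : Finset Γ) : star (F.parity I) = F.parity I :=
  (F.exists_parity I).choose_spec.2.1

theorem parity_mul_parity (I : Finset Γ) : F.parity I * F.parity I = 1 :=
  (F.exists_parity I).choose_spec.2.2.1

theorem parity_mul_c_of_mem {i : Γ} (hi : i ∈ I) : F.parity I * F.c i = -(F.c i * F.parity I) :=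
  (F.exists_parity I).choose_spec.2.2.2.1 i hi

theorem parity_mul_star_c_of_mem {i : Γ} (hi : i ∈ I) :
    F.parity I * star (F.c i) = -(star (F.c i) * F.parity I) := by
  have := congrArg star (F.parity_mul_c_of_mem hi)
  rw [star_neg, star_mul, star_mul, F.star_parity] at this
  rw [this, neg_neg]

theorem parity_mul_c_of_notMem {i : Γ} (hi : i ∉ I) : F.parity I * F.c i = F.c i * F.parity I :=
  (F.exists_parity I).choose_spec.2.2.2.2 i hi

theorem commute_parity_of_mem_loc (h : Disjoint A L) {b : 𝒜} (hb : b ∈ F.loc L) :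
    Commute (F.parity A) b := by
  have loc_le : F.loc L ≤ StarSubalgebra.centralizer ℂ {F.parity A} := by
    refine StarAlgebra.adjoin_le ?_
    rintro _ ⟨j, hj, rfl⟩
    have := F.parity_mul_c_of_notMem (Finset.disjoint_right.mp h hj)
    rw [SetLike.mem_coe, StarSubalgebra.mem_centralizer_iff]
    rintro _ rfl
    rw [F.star_parity]
    exact ⟨this, this⟩
  exact ((StarSubalgebra.mem_centralizer_iff ℂ).mp (loc_le hb) _ rfl).1

theorem grading_eq_parity_mul_mul_parity {a : 𝒜} (ha : a ∈ F.loc I) :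
    F.grading a = F.parity I * a * F.parity I := by
  let u : unitary 𝒜 := ⟨F.parity I, by
    rw [Unitary.mem_iff, F.star_parity, F.parity_mul_parity]; exact ⟨rfl, rfl⟩⟩
  have eqOn : Set.EqOn (F.grading : 𝒜 →⋆ₐ[ℂ] 𝒜) (Unitary.conjStarAlgAut ℂ 𝒜 u : 𝒜 →⋆ₐ[ℂ] 𝒜)
      (F.c '' I) := by
    rintro _ ⟨i, hi, rfl⟩
    change F.grading (F.c i) = F.parity I * F.c i * star (F.parity I)
    rw [F.grading_c, F.star_parity, F.parity_mul_c_of_mem hi, neg_mul, mul_assoc,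
      F.parity_mul_parity, mul_one]
  have := StarAlgHom.adjoin_le_equalizer _ _ eqOn ha
  change F.grading a = F.parity I * a * star (F.parity I) at this
  rwa [F.star_parity] at this

theorem grading_mem_loc {a : 𝒜} (ha : a ∈ F.loc I) : F.grading a ∈ F.loc I := by
  rw [F.grading_eq_parity_mul_mul_parity ha]
  exact mul_mem (mul_mem (F.parity_mem_loc I) ha) (F.parity_mem_loc I)

theorem grading_parity (I : Finset Γ) : F.grading (F.parity I) = F.parity I := by
  rw [F.grading_eq_parity_mul_mul_parity (F.parity_mem_loc I), F.parity_mul_parity, one_mul]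

theorem grading_grading_of_mem_loc {a : 𝒜} (ha : a ∈ F.loc I) : F.grading (F.grading a) = a := by
  rw [F.grading_eq_parity_mul_mul_parity ha, map_mul, map_mul, grading_parity,
    F.grading_eq_parity_mul_mul_parity ha]
  simp only [mul_assoc, F.parity_mul_parity, mul_one]
  rw [← mul_assoc, F.parity_mul_parity, one_mul]

/-- The projection onto the sector with an even number of particles in a finite region. -/
noncomputable def evenProjection (I : Finset Γ) : 𝒜 := (2⁻¹ : ℂ) • (1 + F.parity I)

theorem isStarProjection_evenProjection (I : Finset Γ) : IsStarProjection (F.evenProjection I) where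
  isIdempotentElem := by
    rw [IsIdempotentElem, evenProjection, smul_mul_smul_comm]
    simp only [add_mul, mul_add, one_mul, mul_one, F.parity_mul_parity]
    module
  isSelfAdjoint := by
    simp [IsSelfAdjoint, evenProjection, star_smul, F.star_parity]

theorem evenProjection_mem_loc (I : Finset Γ) : F.evenProjection I ∈ F.loc I :=
  SMulMemClass.smul_mem _ (add_mem (one_mem _) (F.parity_mem_loc I))

theorem grading_evenProjection (I : Finset Γ) :
    F.grading (F.evenProjection I) = F.evenProjection I := by
  rw [evenProjection, map_smul, map_add, map_one, grading_parity]

theorem commute_evenProjection_of_mem_loc (h : Disjoint A L) {b : 𝒜} (hb : b ∈ F.loc L) :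
    Commute (F.evenProjection A) b :=
  ((Commute.one_left b).add_left (F.commute_parity_of_mem_loc h hb)).smul_left _

/-- The Jordan–Wigner embedding of `𝒜(L)` into the commutant of `𝒜(A)`: the grading automorphism is
applied in the sector with an odd number of particles in `A`, which maps `c j` to
`F.parity A * c j`. -/
noncomputable def jordanWigner (h : Disjoint A L) : F.loc L →⋆ₐ[ℂ] 𝒜 :=
  piecewiseStarAlgHom (F.isStarProjection_evenProjection A) (F.loc L).subtype
    ((F.grading : 𝒜 →⋆ₐ[ℂ] 𝒜).comp (F.loc L).subtype)
    (fun b => F.commute_evenProjection_of_mem_loc h b.2)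
    (fun b => F.commute_evenProjection_of_mem_loc h (F.grading_mem_loc b.2))

theorem jordanWigner_apply (h : Disjoint A L) (b : F.loc L) : F.jordanWigner h b =
    F.evenProjection A * b + (1 - F.evenProjection A) * F.grading b := rfl

theorem jordanWigner_c (h : Disjoint A L) {j : Γ} (hj : j ∈ L) :
    F.jordanWigner h ⟨F.c j, F.c_mem j L hj⟩ = F.parity A * F.c j := by
  rw [jordanWigner_apply, F.grading_c, mul_neg, ← sub_eq_add_neg, ← sub_mul, evenProjection]
  congr 1
  module

theorem eq_jordanWigner_add (h : Disjoint A L) {b : 𝒜} (hb : b ∈ F.loc L) :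
    b = F.evenProjection A * F.jordanWigner h ⟨b, hb⟩ +
      (1 - F.evenProjection A) * F.jordanWigner h ⟨F.grading b, F.grading_mem_loc hb⟩ := by
  have hp := (F.isStarProjection_evenProjection A).isIdempotentElem
  rw [jordanWigner_apply, jordanWigner_apply, F.grading_grading_of_mem_loc hb, mul_add, mul_add,
    ← mul_assoc, ← mul_assoc, ← mul_assoc, ← mul_assoc, hp.eq, hp.mul_one_sub_self,
    hp.one_sub_mul_self, hp.one_sub.eq, zero_mul, add_zero, zero_add, ← add_mul,
    add_sub_cancel, one_mul]

theorem parity_mul_c_mem_centralizer {j : Γ} (hj : j ∉ A) :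
    F.parity A * F.c j ∈ StarSubalgebra.centralizer ℂ (F.loc A : Set 𝒜) := by
  refine mem_centralizer_adjoin_iff.mpr ((StarSubalgebra.mem_centralizer_iff ℂ).mpr ?_)
  rintro _ ⟨i, hi, rfl⟩
  have hij : i ≠ j := ne_of_mem_of_not_mem hi hj
  constructor
  · rw [mul_assoc, F.c_anti j i, mul_neg, ← mul_assoc, ← mul_assoc, F.parity_mul_c_of_mem hi,
      neg_mul, neg_neg]
  · rw [mul_assoc, ← neg_eq_iff_eq_neg.mpr (F.star_anti i j hij), mul_neg, ← mul_assoc, ← mul_assoc,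
      F.parity_mul_star_c_of_mem hi, neg_mul, neg_neg]

theorem range_jordanWigner_le_centralizer (h : Disjoint A L) :
    (F.jordanWigner h).range ≤ StarSubalgebra.centralizer ℂ (F.loc A : Set 𝒜) := by
  refine range_le_of_forall_mem _ ?_
  rintro _ ⟨j, hj, rfl⟩
  exact (F.jordanWigner_c h hj).symm ▸
    F.parity_mul_c_mem_centralizer (Finset.disjoint_right.mp h hj)

theorem loc_sup_range_jordanWigner (h : Disjoint A L) :
    F.loc A ⊔ (F.jordanWigner h).range = F.loc (A ∪ L) := by
  have p_mem := F.evenProjection_mem_loc A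
  have A_le := F.loc_mono A (A ∪ L) Finset.subset_union_left
  have L_le := F.loc_mono L (A ∪ L) Finset.subset_union_right
  refine le_antisymm (sup_le A_le ?_) (StarAlgebra.adjoin_le ?_)
  · rintro _ ⟨b, rfl⟩
    exact add_mem (mul_mem (A_le p_mem) (L_le b.2))
      (mul_mem (A_le (sub_mem (one_mem _) p_mem)) (L_le (F.grading_mem_loc b.2)))
  · have A_le' : F.loc A ≤ F.loc A ⊔ (F.jordanWigner h).range := le_sup_left
    have range_mem (b) : F.jordanWigner h b ∈ F.loc A ⊔ (F.jordanWigner h).range :=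
      (le_sup_right : (F.jordanWigner h).range ≤ _) ⟨b, rfl⟩
    rintro _ ⟨i, hi, rfl⟩
    obtain hiA | hiL := Finset.mem_union.mp hi
    · exact A_le' (F.c_mem i A hiA)
    · rw [F.eq_jordanWigner_add h (F.c_mem i L hiL)]
      exact add_mem (mul_mem (A_le' p_mem) (range_mem _))
        (mul_mem (A_le' (sub_mem (one_mem _) p_mem)) (range_mem _))

theorem apply_jordanWigner {φ : State 𝒜} (hφ : F.IsEvenState φ) (h : Disjoint A L) (b : F.loc L) :
    φ (F.jordanWigner h b) = φ (b : 𝒜) := by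
  have odd_part : (1 - F.evenProjection A) * F.grading (b : 𝒜) =
      F.grading ((1 - F.evenProjection A) * b) := by
    rw [map_mul, map_sub, map_one, grading_evenProjection]
  rw [jordanWigner_apply, odd_part, map_add, hφ, ← map_add, ← add_mul, add_sub_cancel, one_mul]

theorem apply_eq_of_isProduct {φ ω : State 𝒜} (hφ : F.IsEvenState φ)
    (hω : φ.IsProduct (F.loc A) ω) (h : Disjoint A L) {b : 𝒜} (hb : b ∈ F.loc L) : ω b = φ b := by
  have p_mem := F.evenProjection_mem_loc A
  have range_mem (b) : F.jordanWigner h b ∈ StarSubalgebra.centralizer ℂ (F.loc A : Set 𝒜) :=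
    F.range_jordanWigner_le_centralizer h ⟨b, rfl⟩
  conv_lhs => rw [F.eq_jordanWigner_add h hb]
  rw [map_add, hω _ p_mem _ (range_mem _),
    hω _ (sub_mem (one_mem _) p_mem) _ (range_mem _), F.apply_jordanWigner hφ,
    F.apply_jordanWigner hφ, hφ, ← add_mul, ← map_add, add_sub_cancel, φ.map_one, one_mul]

theorem isSplitting_jordanWigner [Nontrivial 𝒜] {φ : State 𝒜} (hφ : F.IsEvenState φ)
    (h : Disjoint A L) : F.toQuasiLocal.IsSplitting φ A L (F.jordanWigner h) where
  range_le_centralizer := F.range_jordanWigner_le_centralizer h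
  apply_eq := F.apply_jordanWigner hφ h
  sup_range := F.loc_sup_range_jordanWigner h
  apply_eq_of_isProduct _ hω _ := F.apply_eq_of_isProduct hφ hω h

end FermionSystem

end QLattice

theorem corollary1_general {Γ 𝒜 : Type*} [DecidableEq Γ] [CStarAlgebra 𝒜] {Q : QuasiLocal Γ 𝒜}
    {Φ : Potential Q} {β : ℝ} (hβ : 0 < β) {φ : State 𝒜} {A : Finset Γ}
    (hsplit : ∀ L, Disjoint A L → ∃ θ, Q.IsSplitting φ A L θ)
    (hmin : ∀ ψ : State 𝒜, (∀ a ∈ Q.region (A : Set Γ)ᶜ, ψ a = φ a) →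
      Φ.freeEnergy β A φ ≤ Φ.freeEnergy β A ψ)
    {c : ℝ} (hc : ((‖Φ.surface A‖ : ℝ) : EReal) ≤ (c : EReal) * Φ.area A)
    {B : Set Γ} (hB : Disjoint (A : Set Γ) B) :
    Q.mutualEntropy φ A B ≤ ((2 * β * c : ℝ) : EReal) * Φ.area A := by
  refine (mutualEntropy_le_of_isSplitting hβ hsplit hmin hB).trans ?_
  rw [EReal.coe_mul, EReal.coe_mul _ c, mul_assoc]
  exact mul_le_mul_of_nonneg_left hc (EReal.coe_nonneg.mpr (by positivity))

theorem corollary1 {Γ : Type*} {𝒜 : Type*} [DecidableEq Γ] [CStarAlgebra 𝒜] [Nontrivial 𝒜] :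
    (∀ (S : SpinSystem Γ 𝒜) (Φ : Potential S.toQuasiLocal) (β : ℝ), 0 < β →
      ∀ φ : State 𝒜, Φ.IsLTS β φ →
      ∀ c : ℝ, 0 < c → ∀ A : Finset Γ, ((‖Φ.surface A‖ : ℝ) : EReal) ≤ (c : EReal) * Φ.area A →
      ∀ B : Set Γ, Disjoint (A : Set Γ) B →
        S.toQuasiLocal.mutualEntropy φ A B ≤ ((2 * β * c : ℝ) : EReal) * Φ.area A) ∧
    (∀ (F : FermionSystem Γ 𝒜) (Φ : Potential F.toQuasiLocal), F.IsEvenPotential Φ →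
      ∀ β : ℝ, 0 < β → ∀ φ : State 𝒜, F.IsEvenState φ → Φ.IsLTS β φ →
      ∀ c : ℝ, 0 < c → ∀ A : Finset Γ, ((‖Φ.surface A‖ : ℝ) : EReal) ≤ (c : EReal) * Φ.area A →
      ∀ B : Set Γ, Disjoint (A : Set Γ) B →
        F.toQuasiLocal.mutualEntropy φ A B ≤ ((2 * β * c : ℝ) : EReal) * Φ.area A) := by
  constructor
  · intro S Φ β hβ φ hφ c _ A hA B hB
    exact corollary1_general hβ (fun L => S.exists_isSplitting φ) (hφ A) hA hB
  · intro F Φ _ β hβ φ heven hφ c _ A hA B hB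
    exact corollary1_general hβ (fun L h => ⟨_, F.isSplitting_jordanWigner heven h⟩) (hφ A) hA hB
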